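/- A superoperator $\mathcal L:\mathbb C^{d_{\mathrm{in}}\times d_{\mathrm{in}}}\to\mathbb C^{d_{\mathrm{out}}\times d_{\mathrm{out}}}$ is a linear map; a channel is a completely positive, trace-preserving superoperator. The ACID norm of $\mathcal L$ is $\|\mathcal L\|_J=\|(\mathcal L\otimes\mathcal I_{d_{\mathrm{in}}})\Phi\|_1$, the trace norm of its Choi operator, where $\Phi=\frac1{d_{\mathrm{in}}}\sum_{i,j}|ii\rangle\langle jj|$ is the maximally entangled state. A deterministic ancilla-free, non-adaptive channel tester making $n$ queries consists of pure states $\psi_1,\dots,\psi_n\in\mathbb C^{d_{\mathrm{in}}\times d_{\mathrm{in}}}$, POVMs $P^{(1)},\dots,P^{(n)}$ on $\mathbb C^{d_{\mathrm{out}}\times d_{\mathrm{out}}}$, where $P^{(j)}$ has $m_j$ outcomes, and a function $f:[m_1]\times\dots\times[m_n]\to\{\mathrm{Accept},\mathrm{Reject}\}$. Run on a channel $\mathcal M$, it measures $\mathcal M(\psi_j)$ with $P^{(j)}$ for each $j$, obtaining independent outcomes $x=(x_1,\dots,x_n)$, and outputs $f(x)$. An ancilla-free, non-adaptive channel tester making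 $n$ queries is a random deterministic one. Theorem. There is a universal constant $c>0$ such that the following holds. Let $d_{\mathrm{in}},d_{\mathrm{out}}\ge 2$ be even, let $0<\varepsilon\le 1$, and let $\mathcal N(X)=\operatorname{tr}(X)\,I/d_{\mathrm{out}}$ be the completely depolarizing channel. Suppose that an ancilla-free, non-adaptive channel tester making $n$ queries to an unknown channel $\mathcal M$ decides whether $\mathcal M=\mathcal N$ or $\|\mathcal M-\mathcal N\|_J\ge\varepsilon$ with success probability at least $2/3$; that is, it accepts with probability at least $2/3$ if $\mathcal M=\mathcal N$, and rejects with probability at least $2/3$ for every channel $\mathcal M$ with $\|\mathcal M-\mathcal N\|_J\ge\varepsilon$. Then $n\ge c\,d_{\mathrm{in}}/\varepsilon^2$. -/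

import Mathlib

open scoped Matrix ComplexOrder

namespace ChannelTesting

noncomputable section

/-- Superoperators: linear maps from `a × a` matrices to `b × b` complex matrices. -/
abbrev Superop (a b : ℕ) : Type :=
  Matrix (Fin a) (Fin a) ℂ →ₗ[ℂ] Matrix (Fin b) (Fin b) ℂ

/-- `L ⊗ id_k`, with the tensor product of matrices indexed by pairs: the map `L` is applied
to each block `(X (·, s) (·, t))`. On product inputs this gives `L A ⊗ B`. -/
def tensorId {a b : ℕ} (L : Superop a b) (k : ℕ) :
    Matrix (Fin a × Fin k) (Fin a × Fin k) ℂ →ₗ[ℂ] Matrix (Fin b × Fin k) (Fin b × Fin k) ℂ where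
  toFun X := Matrix.of fun p q => L (Matrix.of fun i j => X (i, p.2) (j, q.2)) p.1 q.1
  map_add' X Y := by
    ext p q
    exact congrFun (congrFun (L.map_add (Matrix.of fun i j => X (i, p.2) (j, q.2))
      (Matrix.of fun i j => Y (i, p.2) (j, q.2))) p.1) q.1
  map_smul' c X := by
    ext p q
    exact congrFun (congrFun (L.map_smul c (Matrix.of fun i j => X (i, p.2) (j, q.2))) p.1) q.1

/-- A quantum channel: a completely positive, trace-preserving superoperator. -/
structure IsChannel {a b : ℕ} (L : Superop a b) : Prop where
  completelyPositive : ∀ (k : ℕ) (X : Matrix (Fin a × Fin k) (Fin a × Fin k) ℂ),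
    X.PosSemidef → (tensorId L k X).PosSemidef
  tracePreserving : ∀ X : Matrix (Fin a) (Fin a) ℂ, (L X).trace = X.trace

/-- The maximally entangled state `Φ_d = (1/d) ∑ i j, |i i⟩⟨j j|`. -/
def maxEntangled (d : ℕ) : Matrix (Fin d × Fin d) (Fin d × Fin d) ℂ :=
  Matrix.of fun p q => if p.1 = p.2 ∧ q.1 = q.2 then (1 / d : ℂ) else 0

/-- The (normalized) Choi operator `J_L = (L ⊗ id) Φ`. -/
def choi {a b : ℕ} (L : Superop a b) : Matrix (Fin b × Fin a) (Fin b × Fin a) ℂ :=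
  tensorId L a (maxEntangled a)

/-- The trace norm: the sum of the singular values. -/
def traceNorm {n : Type*} [Fintype n] [DecidableEq n] (A : Matrix n n ℂ) : ℝ :=
  (Matrix.toEuclideanLin A).singularValues.sum fun _ s => s

/-- The average-case imitation diamond (ACID) norm `‖L‖_J = ‖J_L‖₁`. -/
def acidNorm {a b : ℕ} (L : Superop a b) : ℝ := traceNorm (choi L)

/-- The completely depolarizing map `X ↦ tr(X) I / b`. -/
def depolarizing (a b : ℕ) : Superop a b :=
  (Matrix.traceLinearMap (Fin a) ℂ ℂ).smulRight ((1 / b : ℂ) • (1 : Matrix (Fin b) (Fin b) ℂ))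

/-- A pure state, given by a unit vector (the state itself being `|ψ⟩⟨ψ|`). -/
structure PureState (d : ℕ) where
  vec : Fin d → ℂ
  norm_eq_one : star vec ⬝ᵥ vec = 1

/-- The rank-one density matrix `|ψ⟩⟨ψ|`. -/
def PureState.density {d : ℕ} (ψ : PureState d) : Matrix (Fin d) (Fin d) ℂ :=
  Matrix.vecMulVec ψ.vec (star ψ.vec)

/-- A POVM with finitely many outcomes. -/
structure POVM (d : ℕ) where
  outcomes : ℕ
  effect : Fin outcomes → Matrix (Fin d) (Fin d) ℂ
  posSemidef : ∀ x, (effect x).PosSemidef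
  sum_eq_one : ∑ x, effect x = 1

/-- A deterministic ancilla-free, non-adaptive channel tester making `n` queries:
pure input states, one POVM for each query, and classical post-processing of the string of
measurement outcomes (`true` is "accept", `false` is "reject"). -/
structure Tester (a b n : ℕ) where
  input : Fin n → PureState a
  povm : Fin n → POVM b
  decide : ((j : Fin n) → Fin (povm j).outcomes) → Bool

/-- The probability that the outcomes are `x` when the tester is run on `M`. The `n` systems are
not entangled and are measured separately, so the outcomes are independent. -/
def Tester.outcomeProb {a b n : ℕ} (T : Tester a b n) (M : Superop a b)
    (x : (j : Fin n) → Fin (T.povm j).outcomes) : ℝ :=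
  ∏ j, ((T.povm j).effect (x j) * M (T.input j).density).trace.re

/-- The probability that the tester, run on `M`, outputs `out`. -/
def Tester.outputProb {a b n : ℕ} (T : Tester a b n) (M : Superop a b) (out : Bool) : ℝ :=
  ∑ x with T.decide x = out, T.outcomeProb M x

/-- The coarsest σ-algebra on deterministic testers for which all output probabilities on
channels are measurable; it makes randomized testers as general as possible. -/
instance (a b n : ℕ) : MeasurableSpace (Tester a b n) :=
  ⨆ (M : {M : Superop a b // IsChannel M}) (out : Bool),
    MeasurableSpace.comap (fun T => T.outputProb M.1 out) inferInstance

/-- The probability that a randomized tester, i.e. a random deterministic tester with law `μ`,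
outputs `out` when run on `M`. -/
def randomizedOutputProb {a b n : ℕ} (μ : MeasureTheory.Measure (Tester a b n))
    (M : Superop a b) (out : Bool) : ℝ :=
  ∫ T, T.outputProb M out ∂μ

/-- The randomized tester `μ` decides, with success probability at least `2/3`, whether an unknown
channel `M` is equal to the channel `N` or is `ε`-far from `N` in ACID distance. -/
def CertifiesInACID {a b n : ℕ} (μ : MeasureTheory.Measure (Tester a b n))
    (N : Superop a b) (ε : ℝ) : Prop :=
  ∀ M : Superop a b, IsChannel M →
    (M = N → 2 / 3 ≤ randomizedOutputProb μ M true) ∧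
    (ε ≤ acidNorm (M - N) → 2 / 3 ≤ randomizedOutputProb μ M false)

end

end ChannelTesting

namespace ChannelTesting
open scoped Kronecker
open Matrix

/-! The bound comes from a random family of alternatives `perturbed A β ε`: the depolarizing channel
plus `ε tr(A X) diag(β) / d_out`, with `β` a balanced vector of signs and `A` a Hermitian unitary.
The Choi operator of the perturbation is `ε / (d_in d_out)` times a unitary, so every alternative
lies at ACID distance exactly `ε` (`acidNorm_perturbed_sub`).

A query with input `ψ` feels `A` only through `tr(A ψ)`. For `A` uniform among the signed
reflections this number has second moment at most `2 / d_in`, whatever `ψ` is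
(`sum_sq_re_trace_signedReflection_le`): no single pure input is well aligned with most `A`.

A Hellinger estimate for product distributions (`sq_prod_perturbed_sub_le`) bounds the squared
change of the output probability by `4 ε² ∑ j, tr(A ψ_j)²`, on average at most `8 ε² n / d_in`. A
successful tester must show a change of at least `1/3` for every `A`; averaging over `A` for each
deterministic tester, then over the tester, gives the claim. -/

/-! ### Trace norm, Kraus forms and positivity -/

/-- A scalar multiple of a unitary has all singular values equal to the scalar. -/
theorem traceNorm_of_conjTranspose_mul_self {n : Type*} [Fintype n] [DecidableEq n]
    (A : Matrix n n ℂ) (t : ℝ) (ht : 0 ≤ t) (h : Aᴴ * A = ((t ^ 2 : ℝ) : ℂ) • 1) :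
    traceNorm A = Fintype.card n * t := by
  have hfr : Module.finrank ℂ (EuclideanSpace ℂ n) = Fintype.card n := by simp
  -- The squared singular values are eigenvalues of this operator, which is a scalar, so each must
  -- be `t ^ 2`.
  have hT : LinearMap.adjoint (Matrix.toEuclideanLin A) ∘ₗ Matrix.toEuclideanLin A
      = ((t ^ 2 : ℝ) : ℂ) • LinearMap.id := by
    rw [← Matrix.toEuclideanLin_conjTranspose_eq_adjoint]
    ext v i
    have : Aᴴ *ᵥ (A *ᵥ v.ofLp) = ((t ^ 2 : ℝ) : ℂ) • v.ofLp := by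
      rw [Matrix.mulVec_mulVec, h, Matrix.smul_mulVec, Matrix.one_mulVec]
    simpa [Matrix.toLpLin_apply] using congrFun this i
  have hs : ∀ i < Fintype.card n, (Matrix.toEuclideanLin A).singularValues i = t := by
    intro i hi
    have he := LinearMap.hasEigenvalue_adjoint_comp_self_sq_singularValues
      (Matrix.toEuclideanLin A) (n := i) (by rw [hfr]; exact hi)
    rw [hT] at he
    obtain ⟨v, hv⟩ := he.exists_hasEigenvector
    have h1 := hv.apply_eq_smul
    have h2 := smul_left_injective ℂ hv.2 h1
    have h3 : t ^ 2 = (Matrix.toEuclideanLin A).singularValues i ^ 2 := by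
      have h2' : (((t ^ 2 : ℝ)) : ℂ)
        = (((Matrix.toEuclideanLin A).singularValues i ^ 2 : ℝ) : ℂ) := by
        simpa using h2
      exact_mod_cast h2'
    exact ((pow_left_inj₀ ht (LinearMap.singularValues_nonneg _ _) two_ne_zero).1 h3).symm
  unfold traceNorm
  rw [Finsupp.sum_of_support_subset (s := Finset.range (Fintype.card n))]
  · rw [Finset.sum_congr rfl fun i hi => hs i (Finset.mem_range.1 hi)]
    simp
  · intro i hi
    by_contra hc
    rw [Finset.mem_range, not_lt] at hc
    exact Finsupp.mem_support_iff.1 hi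
      (LinearMap.singularValues_of_finrank_le _ (by rw [hfr]; exact hc))
  · simp

/-- A superoperator in Kraus form is completely positive. -/
theorem tensorId_posSemidef_of_kraus {a b : ℕ} {ι : Type*} [Fintype ι] (L : Superop a b)
    (V : ι → Matrix (Fin b) (Fin a) ℂ) (hL : ∀ X, L X = ∑ m, V m * X * (V m)ᴴ) (k : ℕ)
    (X : Matrix (Fin a × Fin k) (Fin a × Fin k) ℂ) (hX : X.PosSemidef) :
    (tensorId L k X).PosSemidef := by
  have h : tensorId L k X = ∑ m, (V m ⊗ₖ (1 : Matrix (Fin k) (Fin k) ℂ)) * X *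
      (V m ⊗ₖ (1 : Matrix (Fin k) (Fin k) ℂ))ᴴ := by
    ext p q
    simp only [tensorId, LinearMap.coe_mk, AddHom.coe_mk, Matrix.of_apply, hL, Matrix.sum_apply]
    refine Finset.sum_congr rfl fun m _ => ?_
    simp [Matrix.mul_apply, Fintype.sum_prod_type, Matrix.one_apply, Matrix.conjTranspose_apply,
      Finset.sum_mul, mul_assoc, apply_ite (starRingEnd ℂ)]
  rw [h]
  exact Matrix.posSemidef_sum _ fun m _ => hX.mul_mul_conjTranspose_same _

open scoped MatrixOrder in
theorem exists_eq_conjTranspose_mul_self {n : Type*} [Fintype n] [DecidableEq n]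
    {G : Matrix n n ℂ} (hG : G.PosSemidef) : ∃ K : Matrix n n ℂ, G = Kᴴ * K :=
  CStarAlgebra.nonneg_iff_eq_star_mul_self.1 (Matrix.nonneg_iff_posSemidef.2 hG)

/-- Since `A` is a Hermitian involution, `(1 ± A)² = 2 (1 ± A)`, and `1 + u A` is the combination of
`1 + A` and `1 - A` with weights `(1 ± u) / 2 ≥ 0`. -/
theorem posSemidef_one_add_smul {n : Type*} [Fintype n] [DecidableEq n] {A : Matrix n n ℂ}
    (hA : A.IsHermitian) (hA2 : A * A = 1) {u : ℝ} (hu : |u| ≤ 1) :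
    (1 + (u : ℂ) • A).PosSemidef := by
  have hu' := abs_le.1 hu
  have hs : ∀ s : ℝ, ((1 + (s : ℂ) • A)ᴴ * (1 + (s : ℂ) • A)).PosSemidef := fun s =>
    Matrix.posSemidef_conjTranspose_mul_self _
  have hp : (0 : ℂ) ≤ (((1 + u) / 4 : ℝ) : ℂ) := by
    exact_mod_cast (by linarith : (0 : ℝ) ≤ (1 + u) / 4)
  have hm : (0 : ℂ) ≤ (((1 - u) / 4 : ℝ) : ℂ) := by
    exact_mod_cast (by linarith : (0 : ℝ) ≤ (1 - u) / 4)
  have key : 1 + (u : ℂ) • A = (((1 + u) / 4 : ℝ) : ℂ) • ((1 + ((1 : ℝ) : ℂ) • A)ᴴ *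
      (1 + ((1 : ℝ) : ℂ) • A)) + (((1 - u) / 4 : ℝ) : ℂ) • ((1 + ((-1 : ℝ) : ℂ) • A)ᴴ *
      (1 + ((-1 : ℝ) : ℂ) • A)) := by
    have e : ∀ s : ℝ, (1 + (s : ℂ) • A)ᴴ * (1 + (s : ℂ) • A)
        = (1 + (s : ℂ) ^ 2) • (1 : Matrix n n ℂ) + (2 * (s : ℂ)) • A := by
      intro s
      rw [Matrix.conjTranspose_add, Matrix.conjTranspose_one, Matrix.conjTranspose_smul, hA.eq]
      simp only [add_mul, mul_add, one_mul, mul_one, smul_mul_smul_comm, hA2]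
      simp only [RCLike.star_def, Complex.conj_ofReal]
      module
    rw [e, e]
    push_cast
    module
  rw [key]
  exact ((hs 1).smul hp).add ((hs (-1)).smul hm)

/-! ### The perturbed channels and their ACID distance -/

/-- The depolarizing channel, perturbed by the map `X ↦ tr(A X) diag(β) / b`. -/
noncomputable def perturbed {a b : ℕ} (A : Matrix (Fin a) (Fin a) ℂ) (β : Fin b → ℝ) (ε : ℝ) :
    Superop a b :=
  depolarizing a b + (ε : ℂ) • ((Matrix.traceLinearMap (Fin a) ℂ ℂ) ∘ₗ
    (LinearMap.mulLeft ℂ A)).smulRight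
      ((1 / b : ℂ) • (Matrix.diagonal fun i => (β i : ℂ) : Matrix (Fin b) (Fin b) ℂ))

theorem perturbed_apply {a b : ℕ} (A : Matrix (Fin a) (Fin a) ℂ) (β : Fin b → ℝ) (ε : ℝ)
    (X : Matrix (Fin a) (Fin a) ℂ) :
    perturbed A β ε X = X.trace • ((1 / b : ℂ) • (1 : Matrix (Fin b) (Fin b) ℂ)) +
      (ε : ℂ) • (A * X).trace • ((1 / b : ℂ) • Matrix.diagonal fun i => (β i : ℂ)) := by
  simp [perturbed, depolarizing]

/-- Measure-and-prepare form: outcome `i` has effect `(1 + ε β_i A) / b` and prepares the basis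
state `i`. -/
theorem perturbed_eq_diagonal {a b : ℕ} (A : Matrix (Fin a) (Fin a) ℂ) (β : Fin b → ℝ) (ε : ℝ)
    (X : Matrix (Fin a) (Fin a) ℂ) :
    perturbed A β ε X = Matrix.diagonal fun i =>
      (1 / b : ℂ) * ((1 + ((ε * β i : ℝ) : ℂ) • A) * X).trace := by
  rw [perturbed_apply]
  ext i j
  by_cases h : i = j
  · subst h
    simp [add_mul, Matrix.trace_add, Matrix.trace_smul]
    ring
  · simp [h]

theorem isChannel_perturbed {a b : ℕ} (hb : 0 < b) {A : Matrix (Fin a) (Fin a) ℂ}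
    (hA : A.IsHermitian) (hA2 : A * A = 1) {β : Fin b → ℝ} (hβ : ∀ i, |β i| ≤ 1)
    (hβ0 : ∑ i, β i = 0) {ε : ℝ} (hε : |ε| ≤ 1) : IsChannel (perturbed A β ε) := by
  have hb' : (b : ℂ) ≠ 0 := by exact_mod_cast hb.ne'
  constructor
  · have hG : ∀ i, ∃ K : Matrix (Fin a) (Fin a) ℂ,
        (1 / b : ℂ) • (1 + ((ε * β i : ℝ) : ℂ) • A) = Kᴴ * K := by
      intro i
      have h1 : (1 + ((ε * β i : ℝ) : ℂ) • A).PosSemidef := by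
        refine posSemidef_one_add_smul hA hA2 ?_
        rw [abs_mul]
        exact mul_le_one₀ hε (abs_nonneg _) (hβ i)
      have h2 : ((1 / b : ℂ) • (1 + ((ε * β i : ℝ) : ℂ) • A)).PosSemidef := by
        exact h1.smul (by simp)
      exact exists_eq_conjTranspose_mul_self h2
    choose K hK using hG
    -- The Kraus operators are `|i⟩⟨m| K_i`, where `K_iᴴ K_i` is the effect of outcome `i`.
    refine tensorId_posSemidef_of_kraus _
      (fun m : Fin b × Fin a => Matrix.of fun i k => if i = m.1 then K m.1 m.2 k else 0) ?_
    intro X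
    have ht : ∀ i, (1 / b : ℂ) * ((1 + ((ε * β i : ℝ) : ℂ) • A) * X).trace
        = (K i * X * (K i)ᴴ).trace := by
      intro i
      rw [Matrix.trace_mul_comm (K i * X), ← Matrix.mul_assoc, ← hK i, Matrix.smul_mul,
        Matrix.trace_smul, smul_eq_mul]
    rw [perturbed_eq_diagonal]
    simp only [ht]
    ext i j
    rw [Matrix.sum_apply, Fintype.sum_prod_type]
    by_cases h : i = j
    · subst h
      rw [Finset.sum_eq_single i]
      · simp [Matrix.trace, Matrix.mul_apply]
      · intro x _ hx
        simp [Matrix.mul_apply, hx.symm]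
      · simp
    · rw [Matrix.diagonal_apply_ne _ h]
      symm
      refine Finset.sum_eq_zero fun x _ => Finset.sum_eq_zero fun m _ => ?_
      simp only [Matrix.mul_apply, Matrix.of_apply, Matrix.conjTranspose_apply]
      by_cases hx : i = x
      · have : j ≠ x := fun hj => h (hx.trans hj.symm)
        simp [this]
      · simp [hx]
  · intro X
    have h0 : (∑ i, (β i : ℂ)) = 0 := by exact_mod_cast hβ0
    rw [perturbed_apply]
    simp [Matrix.trace_add, Matrix.trace_smul, Matrix.trace_diagonal, h0, hb']

theorem choi_perturbed_sub {a b : ℕ} (A : Matrix (Fin a) (Fin a) ℂ) (β : Fin b → ℝ) (ε : ℝ) :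
    choi (perturbed A β ε - depolarizing a b) =
      ((ε / (b * a) : ℝ) : ℂ) • ((Matrix.diagonal fun i => (β i : ℂ)) ⊗ₖ Aᵀ) := by
  ext p q
  have h : (A * Matrix.of fun i j => if i = p.2 ∧ j = q.2 then (1 / a : ℂ) else 0).trace
      = A q.2 p.2 * (1 / a) := by
    simp only [Matrix.trace, Matrix.diag_apply, Matrix.mul_apply, Matrix.of_apply]
    rw [Finset.sum_eq_single q.2, Finset.sum_eq_single p.2]
    · simp
    · intro x _ hx; simp [hx]
    · simp
    · intro x _ hx; simp [hx]
    · simp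
  simp only [choi, tensorId, maxEntangled, LinearMap.coe_mk, AddHom.coe_mk, Matrix.of_apply,
    perturbed, add_sub_cancel_left, LinearMap.smul_apply, LinearMap.smulRight_apply,
    LinearMap.comp_apply, LinearMap.mulLeft_apply, Matrix.traceLinearMap_apply, h,
    Matrix.smul_apply, Matrix.kroneckerMap_apply, Matrix.transpose_apply, smul_eq_mul]
  push_cast
  ring

/-- `diag(β) ⊗ Aᵀ` is unitary of size `b * a`, which cancels the normalization `ε / (b * a)`. -/
theorem acidNorm_perturbed_sub {a b : ℕ} (ha : 0 < a) (hb : 0 < b)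
    {A : Matrix (Fin a) (Fin a) ℂ} (hA : A.IsHermitian) (hA2 : A * A = 1) {β : Fin b → ℝ}
    (hβ : ∀ i, β i * β i = 1) {ε : ℝ} (hε : 0 ≤ ε) :
    acidNorm (perturbed A β ε - depolarizing a b) = ε := by
  have ha' : (a : ℝ) ≠ 0 := by exact_mod_cast ha.ne'
  have hb' : (b : ℝ) ≠ 0 := by exact_mod_cast hb.ne'
  have hAt : Aᵀᴴ = Aᵀ := hA.transpose.eq
  have hβ' : ∀ i, (β i : ℂ) * β i = 1 := fun i => by exact_mod_cast hβ i
  rw [acidNorm, choi_perturbed_sub,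
    traceNorm_of_conjTranspose_mul_self _ (ε / (b * a)) (by positivity)]
  · simp
    field_simp
  · rw [Matrix.conjTranspose_smul, Matrix.smul_mul, Matrix.mul_smul, smul_smul,
      Matrix.conjTranspose_kronecker, ← Matrix.mul_kronecker_mul, hAt, ← Matrix.transpose_mul,
      hA2, Matrix.diagonal_conjTranspose, Matrix.diagonal_mul_diagonal]
    have : (fun i => star (fun i => (β i : ℂ)) i * (β i : ℂ)) = fun _ : Fin b => (1 : ℂ) := by
      ext i
      simp [hβ']
    rw [this]
    simp [pow_two]

/-! ### Second moments of Rademacher sums -/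

theorem sum_signs_mul {ι : Type*} [Fintype ι] [DecidableEq ι] (p q : ι) :
    ∑ σ : ι → ℤˣ, ((σ p : ℤ) : ℝ) * ((σ q : ℤ) : ℝ) =
      if p = q then (Fintype.card (ι → ℤˣ) : ℝ) else 0 := by
  split_ifs with h
  · subst h
    have : ∀ σ : ι → ℤˣ, ((σ p : ℤ) : ℝ) * ((σ p : ℤ) : ℝ) = 1 := fun σ => by
      rw [← Int.cast_mul, ← Units.val_mul, Int.units_mul_self]
      simp
    simp [this]
  · have key : ∑ σ : ι → ℤˣ, ((σ p : ℤ) : ℝ) * ((σ q : ℤ) : ℝ) =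
        ∑ σ : ι → ℤˣ, -(((σ p : ℤ) : ℝ) * ((σ q : ℤ) : ℝ)) := by
      -- Flipping the sign at `p` alone negates each term.
      refine Fintype.sum_equiv (Equiv.mulLeft (Pi.mulSingle p (-1))) _ _ fun σ => ?_
      simp [Pi.mulSingle_eq_of_ne (Ne.symm h)]
    rw [Finset.sum_neg_distrib] at key
    linarith

/-- Second moment of a Rademacher sum in which every sign is used at most `N` times. -/
theorem sum_signs_sq_le {ι Z : Type*} [Fintype ι] [DecidableEq ι] [Fintype Z]
    (s : Z → ι) (h : Z → ℝ) (N : ℕ) (hN : ∀ p, (Finset.univ.filter fun z => s z = p).card ≤ N) :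
    ∑ σ : ι → ℤˣ, (∑ z, ((σ (s z) : ℤ) : ℝ) * h z) ^ 2 ≤
      Fintype.card (ι → ℤˣ) * (N * ∑ z, h z ^ 2) := by
  have e1 : ∑ σ : ι → ℤˣ, (∑ z, ((σ (s z) : ℤ) : ℝ) * h z) ^ 2 =
      ∑ z, ∑ w, (h z * h w) * ∑ σ : ι → ℤˣ, ((σ (s z) : ℤ) : ℝ) * ((σ (s w) : ℤ) : ℝ) := by
    simp only [Finset.mul_sum]
    simp only [pow_two, Finset.sum_mul_sum]
    rw [Finset.sum_comm]
    refine Finset.sum_congr rfl fun z _ => ?_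
    rw [Finset.sum_comm]
    exact Finset.sum_congr rfl fun w _ => Finset.sum_congr rfl fun σ _ => by ring
  have e2 : ∑ z, ∑ w, (if s z = s w then h z ^ 2 else 0) ≤ N * ∑ z, h z ^ 2 := by
    rw [Finset.mul_sum]
    refine Finset.sum_le_sum fun z _ => ?_
    rw [← Finset.sum_filter, Finset.sum_const, nsmul_eq_mul]
    refine mul_le_mul_of_nonneg_right ?_ (sq_nonneg _)
    simp_rw [eq_comm (a := s z)]
    exact_mod_cast hN (s z)
  have e3 : ∑ z, ∑ w, (if s z = s w then h w ^ 2 else 0) =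
      ∑ z, ∑ w, (if s z = s w then h z ^ 2 else 0) := by
    rw [Finset.sum_comm]
    simp_rw [eq_comm]
  -- Only pairs sharing a sign survive the average; AM-GM and the symmetry `e3` reduce them to
  -- squares, each counted at most `N` times.
  have e4 : ∑ z, ∑ w, (if s z = s w then h z * h w else 0) ≤
      ∑ z, ∑ w, ((if s z = s w then h z ^ 2 else 0) + (if s z = s w then h w ^ 2 else 0)) / 2 := by
    refine Finset.sum_le_sum fun z _ => Finset.sum_le_sum fun w _ => ?_
    split_ifs
    · nlinarith [sq_nonneg (h z - h w)]
    · simp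
  have e5 : ∑ z, ∑ w, ((if s z = s w then h z ^ 2 else 0) + (if s z = s w then h w ^ 2 else 0)) / 2
      = ∑ z, ∑ w, (if s z = s w then h z ^ 2 else 0) := by
    simp only [← Finset.sum_div, Finset.sum_add_distrib, e3]
    ring
  have e6 : ∑ z, ∑ w, (h z * h w) * ∑ σ : ι → ℤˣ, ((σ (s z) : ℤ) : ℝ) * ((σ (s w) : ℤ) : ℝ)
      = Fintype.card (ι → ℤˣ) * ∑ z, ∑ w, (if s z = s w then h z * h w else 0) := by
    simp only [sum_signs_mul]
    rw [Finset.mul_sum]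
    refine Finset.sum_congr rfl fun z _ => ?_
    rw [Finset.mul_sum]
    refine Finset.sum_congr rfl fun w _ => ?_
    split_ifs <;> ring
  rw [e1, e6]
  exact mul_le_mul_of_nonneg_left (by linarith) (by positivity)

/-! ### Signed reflections against pure states -/

/-- The involution `k ↦ c - k` of the cyclic group, decorated with symmetric signs. -/
def signedReflection {a : ℕ} [NeZero a] (c : Fin a) (σ : Sym2 (Fin a) → ℤˣ) :
    Matrix (Fin a) (Fin a) ℂ :=
  Matrix.of fun k l => if k + l = c then ((σ s(k, l) : ℤ) : ℂ) else 0

section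

variable {a : ℕ} [NeZero a] (c : Fin a) (σ : Sym2 (Fin a) → ℤˣ)

theorem signedReflection_isHermitian : (signedReflection c σ).IsHermitian := by
  ext k l
  simp [signedReflection, add_comm l k, Sym2.eq_swap (a := l) (b := k),
    apply_ite (starRingEnd ℂ)]

/-- Reflecting twice is the identity, and the sign is squared because it depends only on the
unordered pair. -/
theorem signedReflection_mul_self : signedReflection c σ * signedReflection c σ = 1 := by
  ext k l
  rw [Matrix.mul_apply, Finset.sum_eq_single (c - k)]
  · by_cases h : k = l
    · subst h
      simp only [signedReflection, Matrix.of_apply, add_sub_cancel, sub_add_cancel, if_true,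
        Sym2.eq_swap (a := c - k) (b := k), Matrix.one_apply_eq]
      rw [← Int.cast_mul, ← Units.val_mul, Int.units_mul_self]
      simp
    · have : ¬ (c - k + l = c) := fun hc => h (by
        have := congrArg (fun t => t + k - c) hc
        simp only [add_sub_cancel_left] at this
        rw [← this]
        abel)
      simp [signedReflection, this, Matrix.one_apply_ne h]
  · intro m _ hm
    have : ¬ (k + m = c) := fun hc => hm (by rw [← hc]; abel)
    simp [signedReflection, this]
  · simp

/-- This exhibits the trace as a Rademacher sum, to which `sum_signs_sq_le` applies. -/
theorem re_trace_signedReflection_mul (v : Fin a → ℂ) :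
    (signedReflection c σ * Matrix.vecMulVec v (star v)).trace.re =
      ∑ z : Fin a × Fin a, ((σ s(z.1, z.2) : ℤ) : ℝ) *
        (if z.1 + z.2 = c then (v z.2 * star (v z.1)).re else 0) := by
  simp only [Matrix.trace, Matrix.diag_apply, Matrix.mul_apply, Fintype.sum_prod_type,
    Complex.re_sum, Matrix.vecMulVec_apply, Pi.star_apply, signedReflection, Matrix.of_apply]
  refine Finset.sum_congr rfl fun k _ => Finset.sum_congr rfl fun l _ => ?_
  split_ifs
  · rw [← Complex.ofReal_intCast, Complex.re_ofReal_mul]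
  · simp

end

theorem PureState.sum_normSq {a : ℕ} (ψ : PureState a) : ∑ k, Complex.normSq (ψ.vec k) = 1 := by
  have h := ψ.norm_eq_one
  have h' : ((∑ k, Complex.normSq (ψ.vec k) : ℝ) : ℂ) = 1 := by
    rw [← h]
    simp [dotProduct, Complex.normSq_eq_conj_mul_self]
  exact_mod_cast h'

theorem sq_re_mul_star_le (z w : ℂ) :
    (z * star w).re ^ 2 ≤ Complex.normSq z * Complex.normSq w := by
  simp only [RCLike.star_def, Complex.mul_re, Complex.conj_re, Complex.conj_im,
    Complex.normSq_apply]
  nlinarith [sq_nonneg (z.re * w.im - z.im * w.re)]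

theorem abs_re_mul_star_le (z w : ℂ) :
    |(z * star w).re| ≤ (Complex.normSq z + Complex.normSq w) / 2 := by
  refine abs_le_of_sq_le_sq ?_ ?_
  · have := sq_re_mul_star_le z w
    nlinarith [sq_nonneg (Complex.normSq z - Complex.normSq w)]
  · have := Complex.normSq_nonneg z
    have := Complex.normSq_nonneg w
    positivity

section

variable {a : ℕ} [NeZero a]

/-- Each row and each column holds one nonzero entry, so AM-GM leaves two halves of `‖ψ‖² = 1`. -/
theorem abs_re_trace_signedReflection_le (c : Fin a) (σ : Sym2 (Fin a) → ℤˣ) (ψ : PureState a) :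
    |(signedReflection c σ * ψ.density).trace.re| ≤ 1 := by
  rw [PureState.density, re_trace_signedReflection_mul]
  refine (Finset.abs_sum_le_sum_abs _ _).trans ?_
  have h1 : ∀ z : Fin a × Fin a, |((σ s(z.1, z.2) : ℤ) : ℝ) *
        (if z.1 + z.2 = c then (ψ.vec z.2 * star (ψ.vec z.1)).re else 0)| ≤
      (if z.1 + z.2 = c then (Complex.normSq (ψ.vec z.2)) / 2 else 0) +
      (if z.1 + z.2 = c then (Complex.normSq (ψ.vec z.1)) / 2 else 0) := by
    intro z
    rw [abs_mul, ← Int.cast_abs, Int.isUnit_iff_abs_eq.1 (σ _).isUnit]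
    split_ifs
    · have := abs_re_mul_star_le (ψ.vec z.2) (ψ.vec z.1)
      simp only [Int.cast_one, one_mul]
      linarith
    · simp
  refine (Finset.sum_le_sum fun z _ => h1 z).trans ?_
  rw [Finset.sum_add_distrib, Fintype.sum_prod_type_right, Fintype.sum_prod_type]
  have e1 : ∀ k l : Fin a, (k + l = c) = (k = c - l) := fun k l => propext eq_sub_iff_add_eq.symm
  have e2 : ∀ k l : Fin a, (k + l = c) = (l = c - k) := fun k l => by rw [add_comm, e1]
  have f1 : ∑ y : Fin a, ∑ x : Fin a, (if x + y = c then Complex.normSq (ψ.vec y) / 2 else 0)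
      = 1 / 2 := by
    simp only [e1, Finset.sum_ite_eq', Finset.mem_univ, if_true, ← Finset.sum_div, ψ.sum_normSq]
  have f2 : ∑ x : Fin a, ∑ y : Fin a, (if x + y = c then Complex.normSq (ψ.vec x) / 2 else 0)
      = 1 / 2 := by
    simp only [e2, Finset.sum_ite_eq', Finset.mem_univ, if_true, ← Finset.sum_div, ψ.sum_normSq]
  rw [f1, f2]
  norm_num

/-- Every ordered pair `(k, l)` belongs to exactly one `c`, so the sum over `c` collects `∑ |ψ_k|²
|ψ_l|² = 1`. The factor `2` arises because `(k, l)` and `(l, k)` share a sign. Dividing by the `a`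
choices of `c` yields the decay `2 / a`. -/
theorem sum_sq_re_trace_signedReflection_le (ψ : PureState a) :
    ∑ c : Fin a, ∑ σ : Sym2 (Fin a) → ℤˣ, (signedReflection c σ * ψ.density).trace.re ^ 2 ≤
      2 * Fintype.card (Sym2 (Fin a) → ℤˣ) := by
  have hN : ∀ p : Sym2 (Fin a),
      (Finset.univ.filter fun z : Fin a × Fin a => s(z.1, z.2) = p).card ≤ 2 := by
    intro p
    induction p with
    | _ x y =>
      refine (Finset.card_le_card (t := {(x, y), (y, x)}) ?_).trans Finset.card_le_two
      rintro ⟨z, w⟩ hz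
      simpa [Sym2.eq_iff] using hz
  have h1 : ∀ c : Fin a,
      ∑ σ : Sym2 (Fin a) → ℤˣ, (signedReflection c σ * ψ.density).trace.re ^ 2 ≤
      Fintype.card (Sym2 (Fin a) → ℤˣ) * (2 * ∑ z : Fin a × Fin a,
        (if z.1 + z.2 = c then Complex.normSq (ψ.vec z.2) * Complex.normSq (ψ.vec z.1) else 0)) := by
    intro c
    simp only [PureState.density, re_trace_signedReflection_mul]
    refine (sum_signs_sq_le (fun z : Fin a × Fin a => s(z.1, z.2)) _ 2 hN).trans ?_
    refine mul_le_mul_of_nonneg_left ?_ (by positivity)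
    push_cast
    refine mul_le_mul_of_nonneg_left (Finset.sum_le_sum fun z _ => ?_) (by positivity)
    split_ifs
    · exact sq_re_mul_star_le _ _
    · simp
  refine (Finset.sum_le_sum fun c _ => h1 c).trans (le_of_eq ?_)
  rw [← Finset.mul_sum, ← Finset.mul_sum, Finset.sum_comm]
  simp only [Finset.sum_ite_eq, Finset.mem_univ, if_true]
  rw [Fintype.sum_prod_type]
  simp only [← Finset.sum_mul, ψ.sum_normSq, one_mul]
  ring

end

/-! ### Hellinger bounds for product distributions -/

/-- This is `√(1 + t) ≥ 1 + t/2 - t²/2` at `t = u r / q`, with `t² ≤ u²`. The linear term cancels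
when summed over outcomes. -/
theorem le_sqrt_mul_perturbed {q r u : ℝ} (hr : |r| ≤ q) (hu : |u| ≤ 1) :
    q + u * r / 2 - u ^ 2 * q / 2 ≤ √(q * (q + u * r)) := by
  apply Real.le_sqrt_of_sq_le
  have hr' := abs_le.1 hr
  have hu2 : u ^ 2 ≤ 1 := (sq_le_one_iff_abs_le_one u).2 hu
  have hq : 0 ≤ q := (abs_nonneg r).trans hr
  have hr2 : r ^ 2 ≤ q ^ 2 := sq_le_sq' (by linarith) hr'.2
  have hur : -q ≤ u * r := by
    have : |u * r| ≤ q := by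
      rw [abs_mul]
      exact (mul_le_of_le_one_left (abs_nonneg _) hu).trans hr
    exact (abs_le.1 this).1
  have h1 : u ^ 2 * r ^ 2 ≤ u ^ 2 * q ^ 2 := mul_le_mul_of_nonneg_left hr2 (sq_nonneg u)
  have h2 : u ^ 2 * (u ^ 2 * q ^ 2) ≤ 1 * (u ^ 2 * q ^ 2) :=
    mul_le_mul_of_nonneg_right hu2 (by positivity)
  have h3 : 0 ≤ u ^ 2 * (q * (u * r + q)) :=
    mul_nonneg (sq_nonneg u) (mul_nonneg hq (by linarith))
  nlinarith

/-- Cauchy-Schwarz on `p - q = (√p - √q)(√p + √q)`: the first factor gives the squared Hellinger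
distance, the second at most `4`. -/
theorem sq_sum_sub_sum_le_bhattacharyya {Ω : Type*} [Fintype Ω] {p q : Ω → ℝ}
    (hp : ∀ x, 0 ≤ p x) (hq : ∀ x, 0 ≤ q x) (hp1 : ∑ x, p x = 1) (hq1 : ∑ x, q x = 1)
    (S : Finset Ω) :
    (∑ x ∈ S, p x - ∑ x ∈ S, q x) ^ 2 ≤ 8 * (1 - ∑ x, √(q x * p x)) := by
  have e : ∀ x, p x - q x = (√(p x) - √(q x)) * (√(p x) + √(q x)) := fun x => by
    linear_combination -Real.sq_sqrt (hp x) + Real.sq_sqrt (hq x)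
  have h1 : ∑ x ∈ S, (√(p x) - √(q x)) ^ 2 ≤ 2 * (1 - ∑ x, √(q x * p x)) := by
    refine (Finset.sum_le_univ_sum_of_nonneg fun x => sq_nonneg _).trans (le_of_eq ?_)
    have : ∀ x, (√(p x) - √(q x)) ^ 2 = p x + q x - 2 * √(q x * p x) := fun x => by
      rw [Real.sqrt_mul (hq x)]
      linear_combination Real.sq_sqrt (hp x) + Real.sq_sqrt (hq x)
    simp only [this, Finset.sum_sub_distrib, Finset.sum_add_distrib, hp1, hq1, ← Finset.mul_sum]
    ring
  have h2 : ∑ x ∈ S, (√(p x) + √(q x)) ^ 2 ≤ 4 := by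
    refine (Finset.sum_le_univ_sum_of_nonneg fun x => sq_nonneg _).trans ?_
    have : ∀ x, (√(p x) + √(q x)) ^ 2 ≤ 2 * p x + 2 * q x := fun x => by
      nlinarith [Real.sq_sqrt (hp x), Real.sq_sqrt (hq x), sq_nonneg (√(p x) - √(q x))]
    refine (Finset.sum_le_sum fun x _ => this x).trans (le_of_eq ?_)
    rw [Finset.sum_add_distrib, ← Finset.mul_sum, ← Finset.mul_sum, hp1, hq1]
    norm_num
  have h0 : 0 ≤ ∑ x ∈ S, (√(p x) - √(q x)) ^ 2 := Finset.sum_nonneg fun x _ => sq_nonneg _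
  rw [← Finset.sum_sub_distrib, Finset.sum_congr rfl fun x _ => e x]
  calc _ ≤ _ := Finset.sum_mul_sq_le_sq_mul_sq _ _ _
    _ ≤ (∑ x ∈ S, (√(p x) - √(q x)) ^ 2) * 4 := mul_le_mul_of_nonneg_left h2 h0
    _ ≤ _ := by linarith

/-- Makes the per-query losses of Bhattacharyya coefficient add up. -/
theorem one_sub_sum_le_prod {ι : Type*} (s : Finset ι) {f d : ι → ℝ} (h0 : ∀ i, 0 ≤ f i)
    (h1 : ∀ i, f i ≤ 1) (hd : ∀ i, 1 - d i ≤ f i) : 1 - ∑ i ∈ s, d i ≤ ∏ i ∈ s, f i := by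
  classical
  induction s using Finset.induction_on with
  | empty => simp
  | insert i s hi ih =>
    rw [Finset.sum_insert hi, Finset.prod_insert hi]
    have hP : ∏ i ∈ s, f i ≤ 1 := Finset.prod_le_one (fun i _ => h0 i) fun i _ => h1 i
    nlinarith [mul_nonneg (sub_nonneg.2 (h1 i)) (sub_nonneg.2 hP), hd i]

/-- Distinguishing a product distribution from a perturbation of it: the squared bias of any event
is at most `4 ∑ u²`. -/
theorem sq_prod_perturbed_sub_le {n : ℕ} {κ : Fin n → Type*} [∀ j, Fintype (κ j)]
    [∀ j, DecidableEq (κ j)] (q r : ∀ j, κ j → ℝ) (u : Fin n → ℝ)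
    (hr : ∀ j x, |r j x| ≤ q j x) (hu : ∀ j, |u j| ≤ 1)
    (hq1 : ∀ j, ∑ x, q j x = 1) (hr0 : ∀ j, ∑ x, r j x = 0) (S : Finset (∀ j, κ j)) :
    (∑ x ∈ S, ∏ j, (q j (x j) + u j * r j (x j)) - ∑ x ∈ S, ∏ j, q j (x j)) ^ 2 ≤
      4 * ∑ j, u j ^ 2 := by
  have hq : ∀ j x, 0 ≤ q j x := fun j x => (abs_nonneg _).trans (hr j x)
  have hp : ∀ j x, 0 ≤ q j x + u j * r j x := fun j x => by
    have : |u j * r j x| ≤ q j x := by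
      rw [abs_mul]
      exact (mul_le_of_le_one_left (abs_nonneg _) (hu j)).trans (hr j x)
    linarith [(abs_le.1 this).1]
  have hp1 : ∀ j, ∑ x, (q j x + u j * r j x) = 1 := fun j => by
    rw [Finset.sum_add_distrib, ← Finset.mul_sum, hq1, hr0]
    simp
  have hsum : ∀ f : ∀ j, κ j → ℝ, ∑ x : ∀ j, κ j, ∏ j, f j (x j) = ∏ j, ∑ x, f j x := fun f => by
    rw [Finset.prod_univ_sum, Fintype.piFinset_univ]
  refine (sq_sum_sub_sum_le_bhattacharyya
    (fun x => Finset.prod_nonneg fun j _ => hp j _)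
    (fun x => Finset.prod_nonneg fun j _ => hq j _)
    (by
      rw [hsum fun j y => q j y + u j * r j y]
      exact Finset.prod_eq_one fun j _ => hp1 j)
    (by rw [hsum]; exact Finset.prod_eq_one fun j _ => hq1 j) S).trans ?_
  -- The Bhattacharyya coefficient factors over queries; each factor loses at most `u j ^ 2 / 2`,
  -- and `8 / 2 = 4`.
  have hsq : ∀ x : ∀ j, κ j, √((∏ j, q j (x j)) * ∏ j, (q j (x j) + u j * r j (x j))) =
      ∏ j, √(q j (x j) * (q j (x j) + u j * r j (x j))) := fun x => by
    rw [← Finset.prod_mul_distrib, Real.sqrt_prod _ fun j _ => mul_nonneg (hq j _) (hp j _)]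
  simp only [hsq]
  rw [hsum fun j y => √(q j y * (q j y + u j * r j y))]
  have hb := one_sub_sum_le_prod Finset.univ
    (f := fun j => ∑ y, √(q j y * (q j y + u j * r j y))) (d := fun j => u j ^ 2 / 2)
    (fun j => Finset.sum_nonneg fun y _ => Real.sqrt_nonneg _)
    (fun j => by
      calc _ ≤ ∑ y, (q j y + (q j y + u j * r j y)) / 2 := Finset.sum_le_sum fun y _ => by
            refine Real.sqrt_le_iff.2 ⟨by linarith [hq j y, hp j y], ?_⟩
            nlinarith [sq_nonneg (u j * r j y)]
        _ = 1 := by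
            rw [← Finset.sum_div, Finset.sum_add_distrib, hq1, hp1]
            norm_num)
    (fun j => by
      calc 1 - u j ^ 2 / 2 = ∑ y, (q j y + u j * r j y / 2 - u j ^ 2 * q j y / 2) := by
            rw [Finset.sum_sub_distrib, Finset.sum_add_distrib, ← Finset.sum_div, ← Finset.sum_div,
              ← Finset.mul_sum, ← Finset.mul_sum, hq1, hr0]
            ring
        _ ≤ _ := Finset.sum_le_sum fun y _ => le_sqrt_mul_perturbed (hr j y) (hu j))
  rw [← Finset.sum_div] at hb
  linarith

/-! ### Outcome statistics of the perturbed channels -/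

section

variable {a b : ℕ} (P : POVM b) (β : Fin b → ℝ)

theorem POVM.effect_diag_nonneg (x : Fin P.outcomes) (i : Fin b) : 0 ≤ (P.effect x i i).re :=
  (Complex.nonneg_iff.1 (P.posSemidef x).diag_nonneg).1

theorem POVM.effect_diag_im (x : Fin P.outcomes) (i : Fin b) : (P.effect x i i).im = 0 :=
  (Complex.nonneg_iff.1 (P.posSemidef x).diag_nonneg).2.symm

theorem POVM.sum_effect_diag (i : Fin b) : ∑ x, (P.effect x i i).re = 1 := by
  have h := congrFun (congrFun P.sum_eq_one i) i
  rw [Matrix.sum_apply, Matrix.one_apply_eq] at h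
  rw [← Complex.re_sum, h, Complex.one_re]

/-- The normalized trace of an effect against a diagonal observable. -/
noncomputable def POVM.bias (x : Fin P.outcomes) : ℝ := (∑ i, β i * (P.effect x i i).re) / b

theorem POVM.sum_bias : ∑ x, P.bias β x = (∑ i, β i) / b := by
  simp only [POVM.bias]
  rw [← Finset.sum_div, Finset.sum_comm]
  simp only [← Finset.mul_sum, P.sum_effect_diag, mul_one]

theorem POVM.abs_bias_le {β : Fin b → ℝ} (hβ : ∀ i, |β i| ≤ 1) (x : Fin P.outcomes) :
    |P.bias β x| ≤ P.bias 1 x := by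
  rw [POVM.bias, POVM.bias, abs_div, Nat.abs_cast]
  refine div_le_div_of_nonneg_right ((Finset.abs_sum_le_sum_abs _ _).trans
    (Finset.sum_le_sum fun i _ => ?_)) (by positivity)
  rw [abs_mul, abs_of_nonneg (P.effect_diag_nonneg x i)]
  exact mul_le_mul_of_nonneg_right (hβ i) (P.effect_diag_nonneg x i)

theorem PureState.trace_density (ψ : PureState a) : ψ.density.trace = 1 := by
  rw [PureState.density, Matrix.trace_vecMulVec, dotProduct_comm, ψ.norm_eq_one]

/-- The output is diagonal, so only diagonals of effects matter. This is the form `q + u r` of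
`sq_prod_perturbed_sub_le`, with `u = ε tr(A ψ)`. -/
theorem POVM.re_trace_effect_mul_perturbed (A : Matrix (Fin a) (Fin a) ℂ) (ε : ℝ)
    (ψ : PureState a) (x : Fin P.outcomes) :
    (P.effect x * perturbed A β ε ψ.density).trace.re =
      P.bias 1 x + (ε * (A * ψ.density).trace.re) * P.bias β x := by
  rw [perturbed_eq_diagonal]
  simp only [POVM.bias, Matrix.trace, Matrix.diag_apply, Matrix.mul_diagonal, Complex.re_sum]
  rw [Finset.sum_div, Finset.sum_div, Finset.mul_sum, ← Finset.sum_add_distrib]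
  refine Finset.sum_congr rfl fun i _ => ?_
  have h := ψ.trace_density
  simp only [Matrix.trace, Matrix.diag_apply] at h
  simp only [add_mul, one_mul, Matrix.smul_mul, Matrix.add_apply, Matrix.smul_apply,
    Finset.sum_add_distrib, ← Finset.mul_sum, h, smul_eq_mul]
  have hi := P.effect_diag_im x i
  have hb : (1 / (b : ℂ)) = ((1 / b : ℝ) : ℂ) := by push_cast; rfl
  rw [hb]
  simp only [Complex.mul_re, Complex.mul_im, hi, Complex.ofReal_re, Complex.ofReal_im,
    Complex.add_re, Complex.one_re, Complex.add_im, Pi.one_apply, ← Complex.re_sum]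
  ring

end

theorem perturbed_zero {a b : ℕ} (A : Matrix (Fin a) (Fin a) ℂ) (β : Fin b → ℝ) :
    perturbed A β 0 = depolarizing a b := by
  simp [perturbed]

theorem Tester.sq_outputProb_perturbed_sub_le {a b n : ℕ} (hb : 0 < b) (T : Tester a b n)
    {A : Matrix (Fin a) (Fin a) ℂ} (hA : ∀ ψ : PureState a, |(A * ψ.density).trace.re| ≤ 1)
    {β : Fin b → ℝ} (hβ : ∀ i, |β i| ≤ 1) (hβ0 : ∑ i, β i = 0) {ε : ℝ} (hε : |ε| ≤ 1)
    (out : Bool) :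
    (T.outputProb (perturbed A β ε) out - T.outputProb (depolarizing a b) out) ^ 2 ≤
      4 * ε ^ 2 * ∑ j, (A * (T.input j).density).trace.re ^ 2 := by
  have hb' : (b : ℝ) ≠ 0 := by exact_mod_cast hb.ne'
  rw [← perturbed_zero A β]
  simp only [Tester.outputProb, Tester.outcomeProb, POVM.re_trace_effect_mul_perturbed, zero_mul,
    add_zero]
  refine (sq_prod_perturbed_sub_le (fun j => (T.povm j).bias 1) (fun j => (T.povm j).bias β)
    (fun j => ε * (A * (T.input j).density).trace.re)
    (fun j x => (T.povm j).abs_bias_le hβ x)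
    (fun j => ?_) (fun j => ?_) (fun j => ?_) _).trans (le_of_eq ?_)
  · rw [abs_mul]
    exact mul_le_one₀ hε (abs_nonneg _) (hA _)
  · rw [POVM.sum_bias]
    simp [hb']
  · rw [POVM.sum_bias, hβ0, zero_div]
  · simp only [mul_pow, ← Finset.mul_sum]
    ring

/-! ### Output probabilities as bounded random variables -/

theorem Tester.outputProb_true_add_false {a b n : ℕ} (T : Tester a b n) {M : Superop a b}
    (hM : IsChannel M) : T.outputProb M true + T.outputProb M false = 1 := by
  have h1 : T.outputProb M true + T.outputProb M false = ∑ x, T.outcomeProb M x := by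
    rw [← Finset.sum_filter_add_sum_filter_not Finset.univ (fun x => T.decide x = true)]
    simp [Tester.outputProb]
  rw [h1]
  simp only [Tester.outcomeProb]
  rw [← Fintype.piFinset_univ, ← Finset.prod_univ_sum
    (f := fun j x => ((T.povm j).effect x * M (T.input j).density).trace.re)]
  refine Finset.prod_eq_one fun j _ => ?_
  rw [← Complex.re_sum, ← Matrix.trace_sum, ← Finset.sum_mul, (T.povm j).sum_eq_one, one_mul,
    hM.tracePreserving, PureState.trace_density, Complex.one_re]

theorem Tester.measurable_outputProb {a b n : ℕ} {M : Superop a b} (hM : IsChannel M)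
    (out : Bool) : Measurable fun T : Tester a b n => T.outputProb M out := by
  rw [measurable_iff_comap_le]
  exact le_iSup₂_of_le (f := fun (M : {M : Superop a b // IsChannel M}) (out : Bool) =>
    MeasurableSpace.comap (fun T : Tester a b n => T.outputProb M.1 out) inferInstance)
    ⟨M, hM⟩ out le_rfl

theorem tensorId_one {a b : ℕ} (L : Superop a b) (X : Matrix (Fin a) (Fin a) ℂ) :
    (tensorId L 1 (X.submatrix Prod.fst Prod.fst)).submatrix (fun i => (i, 0)) (fun i => (i, 0))
      = L X := rfl

/-- Complete positivity with a one-dimensional ancilla. -/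
theorem IsChannel.posSemidef {a b : ℕ} {M : Superop a b} (hM : IsChannel M)
    {X : Matrix (Fin a) (Fin a) ℂ} (hX : X.PosSemidef) : (M X).PosSemidef := by
  rw [← tensorId_one]
  exact (hM.completelyPositive 1 _ (hX.submatrix _)).submatrix _

theorem Tester.outcomeProb_nonneg {a b n : ℕ} (T : Tester a b n) {M : Superop a b}
    (hM : IsChannel M) (x : (j : Fin n) → Fin (T.povm j).outcomes) : 0 ≤ T.outcomeProb M x := by
  refine Finset.prod_nonneg fun j _ => ?_
  have h : (M (T.input j).density).PosSemidef :=
    hM.posSemidef (Matrix.posSemidef_vecMulVec_self_star _)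
  obtain ⟨K, hK⟩ := exists_eq_conjTranspose_mul_self h
  rw [hK, ← Matrix.mul_assoc, Matrix.trace_mul_comm, ← Matrix.mul_assoc]
  exact (Complex.nonneg_iff.1
    (((T.povm j).posSemidef (x j)).mul_mul_conjTranspose_same K).trace_nonneg).1

theorem Tester.outputProb_nonneg {a b n : ℕ} (T : Tester a b n) {M : Superop a b}
    (hM : IsChannel M) (out : Bool) : 0 ≤ T.outputProb M out :=
  Finset.sum_nonneg fun _ _ => T.outcomeProb_nonneg hM _

theorem Tester.outputProb_le_one {a b n : ℕ} (T : Tester a b n) {M : Superop a b}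
    (hM : IsChannel M) (out : Bool) : T.outputProb M out ≤ 1 := by
  have h := T.outputProb_true_add_false hM
  have ht := T.outputProb_nonneg hM true
  have hf := T.outputProb_nonneg hM false
  cases out <;> linarith

theorem integrable_outputProb {a b n : ℕ} (μ : MeasureTheory.Measure (Tester a b n))
    [MeasureTheory.IsProbabilityMeasure μ] {M : Superop a b} (hM : IsChannel M) (out : Bool) :
    MeasureTheory.Integrable (fun T : Tester a b n => T.outputProb M out) μ := by
  refine MeasureTheory.Integrable.of_bound
    (Tester.measurable_outputProb hM out).aestronglyMeasurable 1 (Filter.Eventually.of_forall ?_)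
  intro T
  rw [Real.norm_eq_abs, abs_of_nonneg (T.outputProb_nonneg hM out)]
  exact T.outputProb_le_one hM out

/-! ### Averaging over the alternatives -/

/-- The diagonal of a balanced sign observable. -/
def alternatingSign (b : ℕ) (i : Fin b) : ℝ := (-1) ^ (i : ℕ)

theorem sum_alternatingSign {b : ℕ} (hb : Even b) : ∑ i, alternatingSign b i = 0 := by
  simp only [alternatingSign]
  rw [Fin.sum_univ_eq_sum_range (fun i => (-1 : ℝ) ^ i), neg_one_geom_sum, if_pos hb]

theorem card_le_of_certifies {a b n : ℕ} (ha : 0 < a) (hb : 0 < b) (hb2 : Even b) {ε : ℝ}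
    (hε : 0 < ε) (hε1 : ε ≤ 1) (μ : MeasureTheory.Measure (Tester a b n))
    [MeasureTheory.IsProbabilityMeasure μ] (hμ : CertifiesInACID μ (depolarizing a b) ε) :
    a ≤ 72 * ε ^ 2 * n := by
  have : NeZero a := ⟨ha.ne'⟩
  set β := alternatingSign b with hβ
  have hβabs : ∀ i, |β i| ≤ 1 := fun i => by simp [hβ, alternatingSign]
  have hβsq : ∀ i, β i * β i = 1 := fun i => by simp [hβ, alternatingSign, ← mul_pow]
  have hβ0 : ∑ i, β i = 0 := sum_alternatingSign hb2
  have hεabs : |ε| ≤ 1 := by rwa [abs_of_pos hε]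
  let A : Fin a × (Sym2 (Fin a) → ℤˣ) → Matrix (Fin a) (Fin a) ℂ := fun w =>
    signedReflection w.1 w.2
  have hch : ∀ w, ∀ t : ℝ, |t| ≤ 1 → IsChannel (perturbed (A w) β t) := fun w t ht =>
    isChannel_perturbed hb (signedReflection_isHermitian _ _) (signedReflection_mul_self _ _)
      hβabs hβ0 ht
  have hN : IsChannel (depolarizing a b) := by
    -- The depolarizing channel is the member of the family with `ε = 0`.
    rw [← perturbed_zero (A (0, 1)) β]
    exact hch _ _ (by simp)
  have hgap : ∀ w, 1 / 3 ≤ ∫ T, (T.outputProb (perturbed (A w) β ε) false -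
      T.outputProb (depolarizing a b) false) ∂μ := by
    intro w
    have h1 : 2 / 3 ≤ ∫ T, T.outputProb (depolarizing a b) true ∂μ := (hμ _ hN).1 rfl
    have h2 : 2 / 3 ≤ ∫ T, T.outputProb (perturbed (A w) β ε) false ∂μ :=
      (hμ _ (hch w ε hεabs)).2 (acidNorm_perturbed_sub ha hb (signedReflection_isHermitian _ _)
        (signedReflection_mul_self _ _) hβsq hε.le).ge
    have h3 : ∫ T, T.outputProb (depolarizing a b) true ∂μ +
        ∫ T, T.outputProb (depolarizing a b) false ∂μ = 1 := by
      rw [← MeasureTheory.integral_add (integrable_outputProb μ hN _)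
        (integrable_outputProb μ hN _)]
      simp [Tester.outputProb_true_add_false _ hN]
    rw [MeasureTheory.integral_sub (integrable_outputProb μ (hch w ε hεabs) _)
      (integrable_outputProb μ hN _)]
    linarith
  set S : ℝ := (Fintype.card (Sym2 (Fin a) → ℤˣ) : ℝ) with hS
  have hSpos : 0 < S := by
    rw [hS]
    exact_mod_cast Fintype.card_pos
  have hpt : ∀ T : Tester a b n, ∑ w, (T.outputProb (perturbed (A w) β ε) false -
      T.outputProb (depolarizing a b) false) ≤ a * S / 6 + 12 * ε ^ 2 * n * S := by
    intro T
    have h1 : ∀ w, T.outputProb (perturbed (A w) β ε) false -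
        T.outputProb (depolarizing a b) false ≤
        1 / 6 + 6 * ε ^ 2 * ∑ j, (A w * (T.input j).density).trace.re ^ 2 := by
      intro w
      have h := T.sq_outputProb_perturbed_sub_le hb (A := A w)
        (abs_re_trace_signedReflection_le w.1 w.2) hβabs hβ0 hεabs false
      -- Tangent to the parabola at the required gap `1/3`: `x ≤ 1/6 + (3/2) x²`, and `(3/2) * 4 =
      -- 6`.
      nlinarith [sq_nonneg (T.outputProb (perturbed (A w) β ε) false -
        T.outputProb (depolarizing a b) false - 1 / 3)]
    refine (Finset.sum_le_sum fun w _ => h1 w).trans ?_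
    rw [Finset.sum_add_distrib, ← Finset.mul_sum, Finset.sum_comm]
    have h2 : ∑ j : Fin n, ∑ w, (A w * (T.input j).density).trace.re ^ 2 ≤ n * (2 * S) := by
      refine (Finset.sum_le_card_nsmul _ _ (2 * S) fun j _ => ?_).trans (by simp)
      rw [Fintype.sum_prod_type]
      exact sum_sq_re_trace_signedReflection_le _
    have h3 : ∑ _w : Fin a × (Sym2 (Fin a) → ℤˣ), (1 / 6 : ℝ) = a * S / 6 := by
      rw [Finset.sum_const, Finset.card_univ, Fintype.card_prod, Fintype.card_fin, nsmul_eq_mul,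
        Nat.cast_mul]
      ring
    rw [h3]
    have h4 := mul_le_mul_of_nonneg_left h2 (by positivity : 0 ≤ 6 * ε ^ 2)
    linarith
  have hint : ∀ w, MeasureTheory.Integrable (fun T : Tester a b n =>
      T.outputProb (perturbed (A w) β ε) false - T.outputProb (depolarizing a b) false) μ :=
    fun w => (integrable_outputProb μ (hch w ε hεabs) _).sub (integrable_outputProb μ hN _)
  have hupper := MeasureTheory.integral_mono
    (MeasureTheory.integrable_finsetSum Finset.univ fun w _ => hint w)
    (MeasureTheory.integrable_const (μ := μ) (a * S / 6 + 12 * ε ^ 2 * n * S)) hpt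
  rw [MeasureTheory.integral_finsetSum _ fun w _ => hint w] at hupper
  have hlower : a * S / 3 ≤ ∑ w, ∫ T, (T.outputProb (perturbed (A w) β ε) false -
      T.outputProb (depolarizing a b) false) ∂μ := by
    refine le_trans (le_of_eq ?_) (Finset.sum_le_sum fun w _ => hgap w)
    rw [Finset.sum_const, Finset.card_univ, Fintype.card_prod, Fintype.card_fin, nsmul_eq_mul,
      Nat.cast_mul]
    ring
  have hfin := hlower.trans hupper
  simp only [MeasureTheory.integral_const, MeasureTheory.probReal_univ, one_smul] at hfin
  -- From `a S / 3 ≤ a S / 6 + 12 ε² n S`, multiplied by `6`.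
  have : (a : ℝ) * S ≤ (72 * ε ^ 2 * n) * S := by linarith
  exact le_of_mul_le_mul_right this hSpos

end ChannelTesting

theorem theorem1p10 :
    ∃ c : ℝ, 0 < c ∧
      ∀ (dIn dOut : ℕ), 0 < dIn → 0 < dOut → Even dIn → Even dOut →
      ∀ ε : ℝ, 0 < ε → ε ≤ 1 →
      ∀ (n : ℕ) (μ : MeasureTheory.Measure (ChannelTesting.Tester dIn dOut n)),
        MeasureTheory.IsProbabilityMeasure μ →
        ChannelTesting.CertifiesInACID μ (ChannelTesting.depolarizing dIn dOut) ε →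
        c * (dIn / ε ^ 2) ≤ n := by
  refine ⟨1 / 72, by norm_num, ?_⟩
  intro dIn dOut hIn hOut _ hOut2 ε hε hε1 n μ hμ hcert
  have h := ChannelTesting.card_le_of_certifies hIn hOut hOut2 hε hε1 μ hcert
  rw [← mul_div_assoc, div_le_iff₀ (by positivity)]
  linarith
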